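/- All vector spaces are over a field $\mathbb K$ of characteristic $0$ (of arbitrary dimension). **Lie triple systems.** A Lie triple system is a vector space $L$ with a trilinear bracket satisfying, for all $x,y,z,t,e\in L$, $[x,x,y]=0$, $[x,y,z]+[y,z,x]+[z,x,y]=0$ and $[x,y,[z,t,e]]=[[x,y,z],t,e]+[z,[x,y,t],e]+[z,t,[x,y,e]]$. A representation of $L$ on a vector space $M$ is a bilinear map $\theta:L\times L\to \mathrm{End}(M)$ such that, with $D(x,y)=\theta(y,x)-\theta(x,y)$, $$\theta(z,t)\theta(x,y)-\theta(y,t)\theta(x,z)-\theta(x,[y,z,t])+D(y,z)\theta(x,t)=0,$$ $$\theta(z,t)D(x,y)-D(x,y)\theta(z,t)+\theta([x,y,z],t)+\theta(z,[x,y,t])=0 .$$ Then $(L,[\cdot,\cdot,\cdot],\theta)$ is called an L.t.sRep pair. A $3$-cocycle is a trilinear map $H:L^3\to M$ with $H(x,x,y)=0$, $H(x,y,z)+H(y,z,x)+H(z,x,y)=0$ and $$\begin{aligned}&H(x_1,x_2,[y_1,y_2,y_3])+D(x_1,x_2)H(y_1,y_2,y_3)-H([x_1,x_2,y_1],y_2,y_3)-H(y_1,[x_1,x_2,y_2],y_3)\\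 &=H(y_1,y_2,[x_1,x_2,y_3])+\theta(y_2,y_3)H(x_1,x_2,y_1)-\theta(y_1,y_3)H(x_1,x_2,y_2)+D(y_1,y_2)H(x_1,x_2,y_3).\end{aligned}$$ A linear map $T:M\to L$ is a generalized Reynolds operator on the pair, twisted by $H$, if for all $u,v,w\in M$ $$[Tu,Tv,Tw]=T\big(D(Tu,Tv)w+\theta(Tv,Tw)u-\theta(Tu,Tw)v+H(Tu,Tv,Tw)\big).$$ **Cochains and the graded bracket.** For vector spaces $V,W$ let $C^n(V,W)$, $n\ge 0$, be the space of linear maps $f:(\wedge^2V)^{\otimes n}\otimes V\to W$ whose cyclic sum over the last three entries vanishes (no such condition if $n=0$). On maps of degrees $p,q$ of $n=p,q$ pairs and one further vector of $V$ with values in $V$ put $[P,Q]=P\circ Q-(-1)^{pq}Q\circ P$, where, with $\mathfrak X_i=x_i\wedge y_i$ and $S(a,b)$ the set of $(a,b)$-shuffles, $$\begin{aligned} (P\circ Q)(\mathfrak X_1,\dots,\mathfrak X_{p+q},x)=&\sum_{k=1}^p(-1)^{(k-1)q}\sum_{\sigma\in S(k-1,q)}(-1)^\sigma P\big(\mathfrak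 X_{\sigma(1)},\dots,\mathfrak X_{\sigma(k-1)},\mathfrak Q_{k,\sigma},\mathfrak X_{k+q+1},\dots,\mathfrak X_{p+q},x\big)\\ &+\sum_{\sigma\in S(p,q)}(-1)^{pq}(-1)^\sigma P\big(\mathfrak X_{\sigma(1)},\dots,\mathfrak X_{\sigma(p)},Q(\mathfrak X_{\sigma(p+1)},\dots,\mathfrak X_{\sigma(p+q)},x)\big),\\ \mathfrak Q_{k,\sigma}=&\;Q(\mathfrak X_{\sigma(k)},\dots,\mathfrak X_{\sigma(k+q-1)},x_{k+q})\wedge y_{k+q}+x_{k+q}\wedge Q(\mathfrak X_{\sigma(k)},\dots,\mathfrak X_{\sigma(k+q-1)},y_{k+q}). \end{aligned}$$ **The brackets $l_3,l_4$.** Take $V=L\oplus M$. Regard $C^n(M,L)$ as a space of such maps on $V$: $f$ is applied to the $M$-components of the entries, and its values lie in $L\subseteq V$. Regard $\pi+\theta$ and $H$ as the maps of degree $1$ on $V$ which send $(x+u,y+v,z+w)$ to $[x,y,z]+\theta(y,z)u-\theta(x,z)v+D(x,y)w$ and to $H(x,y,z)\in M$ respectively. For $P,Q,R,S\in C^*(M,L)$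 put $$l_3(P,Q,R)=[[[\pi+\theta,P],Q],R],\qquad l_4(P,Q,R,S)=[[[[H,P],Q],R],S].$$ **Theorem.** Let $(L,[\cdot,\cdot,\cdot],\theta)$ be an L.t.sRep pair with representation space $M$, let $H$ be a $3$-cocycle, and let $T:M\to L$ be a linear map, regarded as an element of $C^0(M,L)$. Then $l_3(T,T,T)$ and $l_4(T,T,T,T)$ lie in $C^1(M,L)$, and $T$ is a generalized Reynolds operator twisted by $H$ if and only if $T$ solves the Maurer–Cartan equation of $(C^*(M,L),l_3,l_4)$, i.e. $$\frac1{3!}\,l_3(T,T,T)+\frac1{4!}\,l_4(T,T,T,T)=0 .$$ -/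

import Mathlib

namespace LTS

/-- A Lie triple system structure on a `K`-vector space `L`: a trilinear bracket `[x, y, z]`, skew in
the first two arguments, satisfying the cyclic identity and the fundamental identity. -/
structure LieTripleSystem (K L : Type*) [Field K] [AddCommGroup L] [Module K L] where
  bracket : L →ₗ[K] L →ₗ[K] L →ₗ[K] L
  bracket_self : ∀ x y, bracket x x y = 0
  cyclic : ∀ x y z, bracket x y z + bracket y z x + bracket z x y = 0
  fundamental : ∀ x y z t e,
    bracket x y (bracket z t e) =
      bracket (bracket x y z) t e + bracket z (bracket x y t) e + bracket z t (bracket x y e)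

/-- A representation of a Lie triple system `L` on a vector space `M`. The pair `(S, ρ)`, for
`ρ : Rep S M`, is what is called an L.t.sRep pair. In the two axioms `D(x, y)` is written out as
`θ(y, x) - θ(x, y)`. -/
structure Rep {K L : Type*} [Field K] [AddCommGroup L] [Module K L]
    (S : LieTripleSystem K L) (M : Type*) [AddCommGroup M] [Module K M] where
  θ : L →ₗ[K] L →ₗ[K] Module.End K M
  rep_one : ∀ x y z t,
    θ z t * θ x y - θ y t * θ x z - θ x (S.bracket y z t) + (θ z y - θ y z) * θ x t = 0
  rep_two : ∀ x y z t,
    θ z t * (θ y x - θ x y) - (θ y x - θ x y) * θ z t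
      + θ (S.bracket x y z) t + θ z (S.bracket x y t) = 0

/-- `D(x, y) = θ(y, x) - θ(x, y)`. -/
def Rep.D {K L M : Type*} [Field K] [AddCommGroup L] [Module K L] [AddCommGroup M] [Module K M]
    {S : LieTripleSystem K L} (ρ : Rep S M) (x y : L) : Module.End K M :=
  ρ.θ y x - ρ.θ x y

/-- A `3`-cocycle of `L` with coefficients in `M`, in the sense of Yamaguti. -/
structure ThreeCocycle {K L M : Type*} [Field K] [AddCommGroup L] [Module K L]
    [AddCommGroup M] [Module K M] {S : LieTripleSystem K L} (ρ : Rep S M) where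
  H : L →ₗ[K] L →ₗ[K] L →ₗ[K] M
  H_self : ∀ x y, H x x y = 0
  cyclic : ∀ x y z, H x y z + H y z x + H z x y = 0
  cocycle : ∀ x₁ x₂ y₁ y₂ y₃,
    H x₁ x₂ (S.bracket y₁ y₂ y₃) + ρ.D x₁ x₂ (H y₁ y₂ y₃)
        - H (S.bracket x₁ x₂ y₁) y₂ y₃ - H y₁ (S.bracket x₁ x₂ y₂) y₃ =
      H y₁ y₂ (S.bracket x₁ x₂ y₃) + ρ.θ y₂ y₃ (H x₁ x₂ y₁)
        - ρ.θ y₁ y₃ (H x₁ x₂ y₂) + ρ.D y₁ y₂ (H x₁ x₂ y₃)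

/-- `T : M → L` is a generalized Reynolds operator on the L.t.sRep pair `(S, ρ)`, twisted by `H`. -/
def IsGeneralizedReynolds {K L M : Type*} [Field K] [AddCommGroup L] [Module K L]
    [AddCommGroup M] [Module K M] {S : LieTripleSystem K L} (ρ : Rep S M) (H : ThreeCocycle ρ)
    (T : M →ₗ[K] L) : Prop :=
  ∀ u v w : M,
    S.bracket (T u) (T v) (T w) =
      T (ρ.D (T u) (T v) w + ρ.θ (T v) (T w) u - ρ.θ (T u) (T w) v + H.H (T u) (T v) (T w))

/-- Arbitrary functions of `n` pairs `𝔛₁, …, 𝔛ₙ` of vectors and one more vector. -/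
abbrev Func (n : ℕ) (V W : Type*) : Type _ := (Fin n → V × V) → V → W

/-- `Cochain K n V W` is the space `Cⁿ(V, W)` of maps `(⋀² V)^{⊗ n} ⊗ V → W` (that is, functions of
`n` pairs and one vector, linear in each of the `2 n + 1` entries and alternating in each pair)
whose cyclic sum over the last three entries vanishes (no condition if `n = 0`). -/
def Cochain (K : Type*) (n : ℕ) (V W : Type*) [Field K] [AddCommGroup V] [Module K V]
    [AddCommGroup W] [Module K W] : Submodule K (Func n V W) where
  carrier := {f |
    (∀ X i y z, IsLinearMap K fun x => f (Function.update X i (x, y)) z) ∧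
    (∀ X i x z, IsLinearMap K fun y => f (Function.update X i (x, y)) z) ∧
    (∀ X, IsLinearMap K fun z => f X z) ∧
    (∀ X i x z, f (Function.update X i (x, x)) z = 0) ∧
    (∀ (X : Fin n → V × V) (i : Fin n) (x y z : V), (i : ℕ) + 1 = n →
      f (Function.update X i (x, y)) z + f (Function.update X i (y, z)) x
        + f (Function.update X i (z, x)) y = 0)}
  add_mem' := by
    rintro f g ⟨f1, f2, f3, f4, f5⟩ ⟨g1, g2, g3, g4, g5⟩
    refine ⟨fun X i y z => ?_, fun X i x z => ?_, fun X => ?_, fun X i x z => ?_,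
      fun X i x y z h => ?_⟩
    · exact ((f1 X i y z).mk' _ + (g1 X i y z).mk' _).isLinear
    · exact ((f2 X i x z).mk' _ + (g2 X i x z).mk' _).isLinear
    · exact ((f3 X).mk' _ + (g3 X).mk' _).isLinear
    · simp [f4, g4]
    · have hf := f5 X i x y z h
      have hg := g5 X i x y z h
      simp only [Pi.add_apply]
      rw [← add_zero (0 : W)]
      nth_rewrite 1 [← hf]
      rw [← hg]
      abel
  zero_mem' :=
    ⟨fun _ _ _ _ => (0 : V →ₗ[K] W).isLinear, fun _ _ _ _ => (0 : V →ₗ[K] W).isLinear,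
      fun _ => (0 : V →ₗ[K] W).isLinear, by simp, by simp⟩
  smul_mem' := by
    rintro c f ⟨f1, f2, f3, f4, f5⟩
    refine ⟨fun X i y z => ?_, fun X i x z => ?_, fun X => ?_, fun X i x z => ?_,
      fun X i x y z h => ?_⟩
    · exact (c • (f1 X i y z).mk' _).isLinear
    · exact (c • (f2 X i x z).mk' _).isLinear
    · exact (c • (f3 X).mk' _).isLinear
    · simp [f4]
    · simp only [Pi.smul_apply, ← smul_add]
      rw [f5 X i x y z h, smul_zero]

/-- The `(a, b)`-shuffles: permutations increasing on the first `a` and on the last `b` indices. -/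
def shuffles (a b : ℕ) : Finset (Equiv.Perm (Fin (a + b))) :=
  Finset.univ.filter fun σ =>
    (∀ i j : Fin a, i < j → σ (Fin.castAdd b i) < σ (Fin.castAdd b j)) ∧
    (∀ i j : Fin b, i < j → σ (Fin.natAdd a i) < σ (Fin.natAdd a j))

section Bracket

variable {V : Type*} [AddCommGroup V]

/-- The entries of `P` in the sums over `k` in `P ∘ Q`, with `k = j + 1`: the pairs
`𝔛_{σ(1)}, …, 𝔛_{σ(k-1)}`, then a pair `Z` in position `k`, then `𝔛_{k+q+1}, …, 𝔛_{p+q}`. -/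
def insertArgs {p q : ℕ} (j : Fin p) (σ : Equiv.Perm (Fin ((j : ℕ) + q)))
    (X : Fin (p + q) → V × V) (Z : V × V) : Fin p → V × V := fun i =>
  if h : (i : ℕ) < j then
    X (Fin.castLE (by omega) (σ (Fin.castAdd q ⟨i, h⟩)))
  else if i = j then Z
  else X ⟨(i : ℕ) + q, by omega⟩

/-- The entries `𝔛_{σ(k)}, …, 𝔛_{σ(k+q-1)}` of `Q` in the sums over `k` in `P ∘ Q`, `k = j + 1`. -/
def innerArgs {p q : ℕ} (j : Fin p) (σ : Equiv.Perm (Fin ((j : ℕ) + q)))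
    (X : Fin (p + q) → V × V) : Fin q → V × V := fun m =>
  X (Fin.castLE (by omega) (σ (Fin.natAdd (j : ℕ) m)))

/-- The product `P ∘ Q`. With `k = j + 1` (so that `j` runs over `0, …, p - 1`), the `(k+q)`-th pair
`𝔛_{k+q} = (x_{k+q}, y_{k+q})` is `X ⟨j + q, _⟩`. -/
def circ {p q : ℕ} (P : Func p V V) (Q : Func q V V) : Func (p + q) V V := fun X x =>
  (∑ j : Fin p, ((-1 : ℤ) ^ ((j : ℕ) * q)) • ∑ σ ∈ shuffles (j : ℕ) q,
      (Equiv.Perm.sign σ : ℤ) •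
        P (insertArgs j σ X
            (Q (innerArgs j σ X) (X ⟨(j : ℕ) + q, by omega⟩).1, (X ⟨(j : ℕ) + q, by omega⟩).2)) x)
  + (∑ j : Fin p, ((-1 : ℤ) ^ ((j : ℕ) * q)) • ∑ σ ∈ shuffles (j : ℕ) q,
      (Equiv.Perm.sign σ : ℤ) •
        P (insertArgs j σ X
            ((X ⟨(j : ℕ) + q, by omega⟩).1, Q (innerArgs j σ X) (X ⟨(j : ℕ) + q, by omega⟩).2)) x)
  + ∑ σ ∈ shuffles p q, ((-1 : ℤ) ^ (p * q)) • (Equiv.Perm.sign σ : ℤ) •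
      P (fun i => X (σ (Fin.castAdd q i))) (Q (fun m => X (σ (Fin.natAdd p m))) x)

/-- The graded bracket `[P, Q] = P ∘ Q - (-1)^{pq} Q ∘ P`, in degree `p + q`. -/
def gradedBracket {p q : ℕ} (P : Func p V V) (Q : Func q V V) : Func (p + q) V V := fun X x =>
  circ P Q X x - ((-1 : ℤ) ^ (p * q)) • circ Q P (fun i => X (Fin.cast (Nat.add_comm q p) i)) x

end Bracket

section Derived

variable {K L M : Type*} [Field K] [AddCommGroup L] [Module K L] [AddCommGroup M] [Module K M]

/-- The identification of a function `f` of elements of `M` with values in `L` with the function on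
`L ⊕ M` that applies `f` to the components in `M`, its values lying in `L ⊆ L ⊕ M`. -/
def lift (K : Type*) (L M : Type*) [Field K] [AddCommGroup L] [Module K L] [AddCommGroup M]
    [Module K M] (n : ℕ) : Func n M L →ₗ[K] Func n (L × M) (L × M) where
  toFun f := fun X x => (f (fun i => ((X i).1.2, (X i).2.2)) x.2, 0)
  map_add' f g := by ext <;> simp
  map_smul' c f := by ext <;> simp

/-- `Cⁿ(M, L)` as a space of functions on `L ⊕ M` with values in `L ⊕ M`. -/
def liftedCochain (K : Type*) (L M : Type*) [Field K] [AddCommGroup L] [Module K L]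
    [AddCommGroup M] [Module K M] (n : ℕ) : Submodule K (Func n (L × M) (L × M)) :=
  (Cochain K n M L).map (lift K L M n)

/-- The element `π + θ` on `L ⊕ M`, of degree `1`: the semidirect product bracket
`([x, y, z], θ(y, z) u - θ(x, z) v + D(x, y) w)` of `x + u`, `y + v`, `z + w`. -/
def piTheta {S : LieTripleSystem K L} (ρ : Rep S M) : Func 1 (L × M) (L × M) := fun X c =>
  let a := (X 0).1
  let b := (X 0).2
  (S.bracket a.1 b.1 c.1, ρ.θ b.1 c.1 a.2 - ρ.θ a.1 c.1 b.2 + ρ.D a.1 b.1 c.2)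

/-- The cocycle `H`, as an element of degree `1` on `L ⊕ M`: `(0, H(x, y, z))`. -/
def cocycleElement {S : LieTripleSystem K L} {ρ : Rep S M} (H : ThreeCocycle ρ) :
    Func 1 (L × M) (L × M) := fun X c =>
  (0, H.H (X 0).1.1 (X 0).2.1 c.1)

/-- `l₃(P, Q, R) = [[[π + θ, P], Q], R]`, in degree `p + q + r + 1`. -/
def l3 {S : LieTripleSystem K L} (ρ : Rep S M) {p q r : ℕ}
    (P : Cochain K p M L) (Q : Cochain K q M L) (R : Cochain K r M L) :
    Func (1 + p + q + r) (L × M) (L × M) :=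
  gradedBracket (gradedBracket (gradedBracket (piTheta ρ)
    (lift K L M p P.1)) (lift K L M q Q.1)) (lift K L M r R.1)

/-- `l₄(P, Q, R, S) = [[[[H, P], Q], R], S]`, in degree `p + q + r + s + 1`. -/
def l4 {S : LieTripleSystem K L} {ρ : Rep S M} (H : ThreeCocycle ρ) {p q r s : ℕ}
    (P : Cochain K p M L) (Q : Cochain K q M L) (R : Cochain K r M L) (U : Cochain K s M L) :
    Func (1 + p + q + r + s) (L × M) (L × M) :=
  gradedBracket (gradedBracket (gradedBracket (gradedBracket (cocycleElement H)
    (lift K L M p P.1)) (lift K L M q Q.1)) (lift K L M r R.1)) (lift K L M s U.1)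

/-- A linear map `T : M → L` as an element of `C⁰(M, L)`. -/
def ofLinear (T : M →ₗ[K] L) : Cochain K 0 M L :=
  ⟨fun _ u => T u, fun _ i => i.elim0, fun _ i => i.elim0, fun _ => T.isLinear,
    fun _ i => i.elim0, fun _ i => i.elim0⟩

end Derived

end LTS

namespace LTS

section Derivation

variable {V : Type*} [AddCommGroup V]

/-! Let `s` be the endomorphism `(x, u) ↦ (T u, 0)` of `L × M`. Bracketing a ternary operation `P`
with `s` lets `s` act as a derivation: apply `s` to each of the three entries in turn, sum, and
subtract `s ∘ P` (`gradedBracket_one_zero`). Since `s ∘ s = 0`, an iterated bracket keeps only terms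
with at most one `s` on each entry and at most one outside. For `π + θ` and three brackets, either
all entries receive `s`, or two do and one `s` is outside. Each such term arises in `3! = 6` orders,
the outer ones with sign `-1`, giving six times the untwisted defect of `T`. For `H` and four
brackets, only `-s H(s, s, s)` survives, in `4! = 24` orders. Division by `3!` and `4!`, legitimate
in characteristic `0`, leaves exactly the Reynolds equation. -/

theorem shuffles_eq_singleton {a b : ℕ} [Subsingleton (Equiv.Perm (Fin (a + b)))]
    (h : a + b ≤ 1) : shuffles a b = {1} := by
  ext σ
  simp only [shuffles, Finset.mem_filter, Finset.mem_univ, true_and, Finset.mem_singleton,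
    Subsingleton.elim σ 1, iff_true]
  exact ⟨fun i j hij => by have := Fin.lt_def.1 hij; omega,
    fun i j hij => by have := Fin.lt_def.1 hij; omega⟩

/-- The graded bracket of a map of degree `1` with a map of degree `0`. -/
theorem gradedBracket_one_zero (P : Func 1 V V) (s : V → V) :
    (gradedBracket P (fun _ => s : Func 0 V V) : Func 1 V V) = fun X z =>
      P (fun _ => (s (X 0).1, (X 0).2)) z + P (fun _ => ((X 0).1, s (X 0).2)) z
        + P X (s z) - s (P X z) := by
  -- Every shuffle occurring here permutes at most one index, so each sum over shuffles reduces to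
  -- the identity.
  have h00 : shuffles 0 0 = {1} :=
    haveI : Subsingleton (Equiv.Perm (Fin (0 + 0))) :=
      inferInstanceAs (Subsingleton (Equiv.Perm (Fin 0)))
    shuffles_eq_singleton (by norm_num)
  have h10 : shuffles 1 0 = {1} :=
    haveI : Subsingleton (Equiv.Perm (Fin (1 + 0))) :=
      inferInstanceAs (Subsingleton (Equiv.Perm (Fin 1)))
    shuffles_eq_singleton (by norm_num)
  have h01 : shuffles 0 1 = {1} :=
    haveI : Subsingleton (Equiv.Perm (Fin (0 + 1))) :=
      inferInstanceAs (Subsingleton (Equiv.Perm (Fin 1)))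
    shuffles_eq_singleton (by norm_num)
  have hins : ∀ (σ : Equiv.Perm (Fin (((0 : Fin 1) : ℕ) + 0))) (X : Fin (1 + 0) → V × V)
      (Z : V × V), insertArgs (p := 1) (q := 0) 0 σ X Z = fun _ => Z := by
    intro σ X Z
    funext i
    obtain rfl := Subsingleton.elim i 0
    simp [insertArgs]
  funext X z
  have hX : ∀ (Y : Fin 1 → V × V), Y 0 = X 0 → Y = X := fun Y h => by
    funext i
    rw [Subsingleton.elim i 0, h]
  simp only [gradedBracket, circ, Finset.univ_unique, Finset.sum_singleton, Fin.default_eq_zero,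
    Finset.univ_eq_empty, Finset.sum_empty, hins, zero_mul, mul_zero, pow_zero, one_smul, zero_add,
    h10, h01]
  -- The first index here is the value of `0 : Fin 1`, which agrees with the literal `0` only after
  -- unfolding.
  erw [h00]
  simp only [Finset.sum_singleton, Equiv.Perm.sign_one, Units.val_one, one_smul]
  congr 3
  exact hX _ rfl

end Derivation

section Reynolds

variable {K L M : Type*} [Field K] [AddCommGroup L] [Module K L] [AddCommGroup M] [Module K M]
  {S : LieTripleSystem K L}

theorem lift_ofLinear (T : M →ₗ[K] L) :
    lift K L M 0 (ofLinear T).1 = fun _ x => (T x.2, 0) := rfl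

/-- The failure of `T` to intertwine the brackets of `M` and `L`, for the untwisted bracket. -/
def defect (ρ : Rep S M) (T : M →ₗ[K] L) : Func 1 M L := fun X w =>
  S.bracket (T (X 0).1) (T (X 0).2) (T w)
    - T (ρ.D (T (X 0).1) (T (X 0).2) w + ρ.θ (T (X 0).2) (T w) (X 0).1
      - ρ.θ (T (X 0).1) (T w) (X 0).2)

/-- The contribution of the cocycle to the bracket of `M` induced by `T`, mapped to `L`. -/
def twist {ρ : Rep S M} (H : ThreeCocycle ρ) (T : M →ₗ[K] L) : Func 1 M L := fun X w =>
  T (H.H (T (X 0).1) (T (X 0).2) (T w))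

/-- The two-entry terms `s P(s, s, ·)`, `s P(·, s, s)` and `s P(s, ·, s)` produce the `D`-term and
the two `θ`-terms of the defect. -/
theorem l3_ofLinear (ρ : Rep S M) (T : M →ₗ[K] L) :
    (l3 ρ (ofLinear T) (ofLinear T) (ofLinear T) : Func 1 (L × M) (L × M)) =
      lift K L M 1 ((6 : K) • defect ρ T) := by
  rw [l3, lift_ofLinear]
  -- The nominal degree `1 + 0 + 0 + 0` is `1` only by computation, hence `erw`.
  erw [gradedBracket_one_zero, gradedBracket_one_zero, gradedBracket_one_zero]
  funext X z
  ext
  · simp [piTheta, lift, defect, Rep.D]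
    module
  · simp [piTheta, lift, defect, Rep.D]

/-- The values of `H` lie in `M`, where `s` acts as `T`. The single `s` outside accounts for the
sign. -/
theorem l4_ofLinear {ρ : Rep S M} (H : ThreeCocycle ρ) (T : M →ₗ[K] L) :
    (l4 H (ofLinear T) (ofLinear T) (ofLinear T) (ofLinear T) : Func 1 (L × M) (L × M)) =
      lift K L M 1 (-(24 : K) • twist H T) := by
  rw [l4, lift_ofLinear]
  erw [gradedBracket_one_zero, gradedBracket_one_zero, gradedBracket_one_zero,
    gradedBracket_one_zero]
  funext X z
  ext
  · simp [cocycleElement, lift, twist]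
    module
  · simp [cocycleElement, lift, twist]

theorem mem_cochain_one {V W : Type*} [AddCommGroup V] [Module K V] [AddCommGroup W] [Module K W]
    {f : Func 1 V W} (g : V →ₗ[K] V →ₗ[K] V →ₗ[K] W) (hfg : ∀ X z, f X z = g (X 0).1 (X 0).2 z)
    (hself : ∀ x z, g x x z = 0) (hcyc : ∀ x y z, g x y z + g y z x + g z x y = 0) :
    f ∈ Cochain K 1 V W := by
  have hu : ∀ (X : Fin 1 → V × V) (i : Fin 1) (Z : V × V), Function.update X i Z 0 = Z :=
    fun X i Z => by rw [Subsingleton.elim i 0, Function.update_self]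
  refine ⟨fun X i y z => ?_, fun X i x z => ?_, fun X => ?_, fun X i x z => ?_,
    fun X i x y z _ => ?_⟩
  · simp only [hfg, hu]
    exact ((g.flip y).flip z).isLinear
  · simp only [hfg, hu]
    exact ((g x).flip z).isLinear
  · simp only [hfg]
    exact (g (X 0).1 (X 0).2).isLinear
  · simp only [hfg, hu, hself]
  · simp only [hfg, hu, hcyc]

/-- Both symmetries hold separately for the bracket part and the `θ` part: in the latter, `D(x, x) =
0` and the cyclic sum cancels once `D` is expanded in `θ`. -/
theorem defect_mem (ρ : Rep S M) (T : M →ₗ[K] L) : defect ρ T ∈ Cochain K 1 M L := by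
  let g : M →ₗ[K] M →ₗ[K] M →ₗ[K] L :=
    LinearMap.mk₂ K
      (fun u v =>
        { toFun := fun w => defect ρ T (fun _ => (u, v)) w
          map_add' := fun w w' => by simp [defect, Rep.D]; abel
          map_smul' := fun c w => by simp [defect, Rep.D]; module })
      (fun u u' v => by ext w; simp [defect, Rep.D]; abel)
      (fun c u v => by ext w; simp [defect, Rep.D]; module)
      (fun u v v' => by ext w; simp [defect, Rep.D]; abel)
      (fun c u v => by ext w; simp [defect, Rep.D]; module)
  have hg : ∀ u v w, g u v w = defect ρ T (fun _ => (u, v)) w := fun _ _ _ => rfl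
  refine mem_cochain_one g (fun X w => rfl) (fun u w => ?_) (fun u v w => ?_)
  · simp [hg, defect, Rep.D, S.bracket_self]
  · have h := S.cyclic (T u) (T v) (T w)
    simp only [hg, defect, Rep.D, LinearMap.sub_apply, map_add, map_sub]
    rw [← h]
    abel

theorem twist_mem {ρ : Rep S M} (H : ThreeCocycle ρ) (T : M →ₗ[K] L) :
    twist H T ∈ Cochain K 1 M L := by
  let g : M →ₗ[K] M →ₗ[K] M →ₗ[K] L :=
    LinearMap.mk₂ K (fun u v => T ∘ₗ H.H (T u) (T v) ∘ₗ T)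
      (fun u u' v => by ext w; simp)
      (fun c u v => by ext w; simp)
      (fun u v v' => by ext w; simp)
      (fun c u v => by ext w; simp)
  have hg : ∀ u v w, g u v w = T (H.H (T u) (T v) (T w)) := fun _ _ _ => rfl
  refine mem_cochain_one g (fun X w => rfl) (fun u w => ?_) (fun u v w => ?_)
  · rw [hg, H.H_self, map_zero]
  · rw [hg, hg, hg, ← map_add, ← map_add, H.cyclic, map_zero]

/-- Evaluation at entries `(0, u)` recovers the original map, so the Maurer–Cartan equation on `L ×
M` can be tested on `M`. -/
theorem lift_injective (n : ℕ) : Function.Injective (lift K L M n) := by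
  intro f g h
  funext X x
  exact congrArg Prod.fst (congrFun (congrFun h fun i => ((0, (X i).1), (0, (X i).2))) (0, x))

theorem isGeneralizedReynolds_iff {ρ : Rep S M} (H : ThreeCocycle ρ) (T : M →ₗ[K] L) :
    IsGeneralizedReynolds ρ H T ↔ defect ρ T - twist H T = 0 := by
  constructor
  · intro h
    funext X w
    have h' := h (X 0).1 (X 0).2 w
    rw [map_add] at h'
    simp only [Pi.sub_apply, defect, twist, h', Pi.zero_apply]
    abel
  · intro h u v w
    have h' : defect ρ T (fun _ => (u, v)) w - twist H T (fun _ => (u, v)) w = 0 :=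
      congrFun (congrFun h fun _ => (u, v)) w
    rw [← sub_eq_zero, ← h', map_add, defect, twist, sub_sub]

end Reynolds

end LTS

theorem mainTheorem1 {K L M : Type*} [Field K] [CharZero K]
    [AddCommGroup L] [Module K L] [AddCommGroup M] [Module K M]
    (S : LTS.LieTripleSystem K L) (ρ : LTS.Rep S M) (H : LTS.ThreeCocycle ρ) (T : M →ₗ[K] L) :
    let t : LTS.Cochain K 0 M L := LTS.ofLinear T
    let l3TTT : LTS.Func 1 (L × M) (L × M) := LTS.l3 ρ t t t
    let l4TTTT : LTS.Func 1 (L × M) (L × M) := LTS.l4 H t t t t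
    l3TTT ∈ LTS.liftedCochain K L M 1 ∧
    l4TTTT ∈ LTS.liftedCochain K L M 1 ∧
    (LTS.IsGeneralizedReynolds ρ H T ↔
      ((1 : K) / (Nat.factorial 3 : K)) • l3TTT + ((1 : K) / (Nat.factorial 4 : K)) • l4TTTT = 0) := by
  intro t l3TTT l4TTTT
  have h3 : l3TTT = LTS.lift K L M 1 ((6 : K) • LTS.defect ρ T) := LTS.l3_ofLinear ρ T
  have h4 : l4TTTT = LTS.lift K L M 1 (-(24 : K) • LTS.twist H T) := LTS.l4_ofLinear H T
  have hsum : ((1 : K) / (Nat.factorial 3 : K)) • l3TTT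
      + ((1 : K) / (Nat.factorial 4 : K)) • l4TTTT =
        LTS.lift K L M 1 (LTS.defect ρ T - LTS.twist H T) := by
    -- The scalars become `6 / 3! = 1` and `-24 / 4! = -1`.
    rw [h3, h4, ← map_smul, ← map_smul, ← map_add, smul_smul, smul_smul]
    norm_num [Nat.factorial]
    abel
  refine ⟨?_, ?_, ?_⟩
  · rw [h3]
    exact Submodule.mem_map_of_mem (Submodule.smul_mem _ _ (LTS.defect_mem ρ T))
  · rw [h4]
    exact Submodule.mem_map_of_mem (Submodule.smul_mem _ _ (LTS.twist_mem H T))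
  · rw [hsum, LTS.isGeneralizedReynolds_iff, map_eq_zero_iff _ (LTS.lift_injective 1)]
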